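/- Let $d\ge 1$, let $e\in\mathbb S^d=\{x\in\mathbb R^{d+1}:\|x\|=1\}$, let $\mathrm{Tan}_e=e+e^\perp$ be the affine tangent hyperplane of $\mathbb S^d$ at $e$, and let $I_e:\mathrm{Tan}_e\to\mathbb R^d$ be an isometry with $I_e(e)=0$. For $n\in\mathbb N$ let $R_n=\mathrm{pos}(X_1,\dots,X_n)$ be the set of all linear combinations with non-negative coefficients of $X_1,\dots,X_n$, where $X_1,\dots,X_n$ are independent random points with the uniform distribution on the half-sphere $\{x\in\mathbb S^d:\langle x,e\rangle\ge 0\}$. Let $\Pi$ be a Poisson point process on $\mathbb R^d\setminus\{0\}$ whose intensity measure has density $y\mapsto\frac{2}{\omega_{d+1}}\|y\|^{-(d+1)}$ with respect to Lebesgue measure, where $\omega_{d+1}=2\pi^{(d+1)/2}/\Gamma(\frac{d+1}{2})$. Let $\mathcal K^d$ be the space of non-empty compact convex subsets of $\mathbb R^d$ with the Hausdorff metric. Then $n^{-1}I_e(R_n\cap\mathrm{Tan}_e)$ (for every $n\ge 1$) and the convex hull $\mathrm{conv}(\Pi)$ belong to $\mathcal K^d$ almost surely, and, as $n\to\infty$,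 $$n^{-1}I_e(R_n\cap\mathrm{Tan}_e)\longrightarrow\mathrm{conv}(\Pi)\quad\text{weakly on }\mathcal K^d,$$ where on the exceptional null events (and for $n=0$) the random sets are replaced by $\{0\}$. -/

import Mathlib

open MeasureTheory ProbabilityTheory Filter Topology
open scoped Pointwise ENNReal NNReal

/-- `ℝ^k` with its Euclidean inner product and norm. -/
abbrev Euc (k : ℕ) : Type := EuclideanSpace ℝ (Fin k)

/-- The unit sphere `𝕊^d` of `ℝ^(d+1)`. -/
abbrev UnitSphere (d : ℕ) : Type := Metric.sphere (0 : Euc (d + 1)) 1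

/-- The space of non-empty compact convex sets is `ConvexBody` in Mathlib, with the Hausdorff
metric; it is given its Borel σ-algebra. -/
noncomputable instance ConvexBody.instMeasurableSpaceBorel {V : Type*} [NormedAddCommGroup V]
    [NormedSpace ℝ V] : MeasurableSpace (ConvexBody V) := borel _

instance ConvexBody.instBorelSpace {V : Type*} [NormedAddCommGroup V]
    [NormedSpace ℝ V] : BorelSpace (ConvexBody V) := ⟨rfl⟩

/-- `K` is a non-empty compact convex subset of `ℝ^d`. -/
def IsCompactConvex {d : ℕ} (K : Set (Euc d)) : Prop :=
  Convex ℝ K ∧ IsCompact K ∧ K.Nonempty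

open Classical in
/-- A non-empty compact convex set as a point of the space of all such sets; any other set is sent
to the (arbitrary) value `{0}`. -/
noncomputable def toConvexBody {d : ℕ} (K : Set (Euc d)) : ConvexBody (Euc d) :=
  if h : IsCompactConvex K then ⟨K, h.1, h.2.1, h.2.2⟩ else 0

theorem coe_toConvexBody {d : ℕ} {K : Set (Euc d)} (h : IsCompactConvex K) :
    (toConvexBody K : Set (Euc d)) = K := by
  rw [toConvexBody, dif_pos h]
  rfl

/-- The uniform distribution on the closed upper half-sphere
`{x ∈ 𝕊^d : ⟨x, e⟩ ≥ 0}`: the normalised restriction of the surface measure. -/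
noncomputable def halfSphereUniform {d : ℕ} (e : UnitSphere d) : Measure (UnitSphere d) :=
  ProbabilityTheory.cond (volume : Measure (Euc (d + 1))).toSphere
    {x : UnitSphere d | 0 ≤ inner ℝ (x : Euc (d + 1)) (e : Euc (d + 1))}

/-- The tangent space of `𝕊^d` at `v`, as the affine hyperplane `v + v^⊥` of `ℝ^(d+1)`. -/
def Tan {d : ℕ} (v : UnitSphere d) : Set (Euc (d + 1)) :=
  {x | inner ℝ (x - (v : Euc (d + 1))) (v : Euc (d + 1)) = 0}

theorem self_mem_Tan {d : ℕ} (v : UnitSphere d) : (v : Euc (d + 1)) ∈ Tan v := by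
  simp [Tan]

/-- The positive hull `pos(x_1, …, x_n)`: all linear combinations with non-negative
coefficients. -/
def posHull {d n : ℕ} (x : Fin n → UnitSphere d) : Set (Euc (d + 1)) :=
  (PointedCone.hull ℝ (Set.range fun i => (x i : Euc (d + 1))) : Set (Euc (d + 1)))

/-- `I (C ∩ Tan_e)`, for a map `I` from `Tan_e` to `ℝ^d`. -/
def profile {d : ℕ} (e : UnitSphere d) (I : Tan e → Euc d) (C : Set (Euc (d + 1))) :
    Set (Euc d) :=
  I '' {y : Tan e | (y : Euc (d + 1)) ∈ C}

/-- The surface area `ω_k = 2 π^(k/2) / Γ(k/2)` of the unit sphere of `ℝ^k`. -/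
noncomputable def sphereArea (k : ℕ) : ℝ :=
  2 * Real.pi ^ ((k : ℝ) / 2) / Real.Gamma ((k : ℝ) / 2)

/-- `ℝ^d ∖ {0}`, as a subtype of `ℝ^d`. -/
abbrev PuncturedEuc (d : ℕ) : Type := {y : Euc d // y ≠ 0}

/-- The measure on `ℝ^d ∖ {0}` with Lebesgue density `(2 / ω_(d+1)) ‖y‖^-(d+1)`. -/
noncomputable def poissonIntensity (d : ℕ) : Measure (PuncturedEuc d) :=
  (Measure.comap (fun y : PuncturedEuc d => (y : Euc d)) volume).withDensity fun y =>
    ENNReal.ofReal (2 / sphereArea (d + 1) * (1 / ‖(y : Euc d)‖ ^ (d + 1)))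

/-- The Poisson distribution with parameter `r ∈ [0, ∞]`, on `{0, 1, 2, …, ∞}`; for `r = ∞` it is
the point mass at `∞`. -/
noncomputable def extPoisson (r : ℝ≥0∞) : Measure ℕ∞ :=
  if r = ∞ then Measure.dirac ⊤ else (poissonMeasure r.toNNReal).map (fun k : ℕ => (k : ℕ∞))

/-- `Φ` is a (simple) Poisson point process on `S` with intensity measure `μ`, seen as a random set
of points: the number of points in a measurable set `B` is a random variable, Poisson distributed
with parameter `μ B`, and the numbers of points in pairwise disjoint measurable sets are
independent. (Almost surely, only finitely many points lie in a given set of finite intensity.) -/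
structure IsPoissonProcess {Ω S : Type*} [MeasurableSpace Ω] [MeasurableSpace S]
    (Φ : Ω → Set S) (μ : Measure S) (P : Measure Ω) : Prop where
  measurable_count : ∀ B : Set S, MeasurableSet B → Measurable fun ω => (Φ ω ∩ B).encard
  law_count : ∀ B : Set S, MeasurableSet B →
    HasLaw (fun ω => (Φ ω ∩ B).encard) (extPoisson (μ B)) P
  indep_count : ∀ (k : ℕ) (B : Fin k → Set S), (∀ i, MeasurableSet (B i)) →
    Pairwise (fun i j => Disjoint (B i) (B j)) →
    iIndepFun (fun i ω => (Φ ω ∩ B i).encard) P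

/-!
The random sets are compared through their void probabilities. If `Ψ n` and `Φ` are random subsets
of `ℝ^d` whose convex hulls are almost surely compact, and if `P (Ψ n ∩ A = ∅) → P (Φ ∩ A = ∅)` for
all measurable `A`, then the hulls converge in distribution (`tendsto_integral_toConvexBody`). To
see this, cover a large ball by finitely many balls of radius `ε`. As long as a random set stays in
the large ball, its hull is within Hausdorff distance `ε` of the hull of the centres of those small
balls that it hits. The joint law of the family of small balls that are hit is, by
inclusion-exclusion, a linear combination of void probabilities of unions of these balls, so it
converges; the small balls need not be disjoint, and no independence is used. The same
approximation shows that the hulls are measurable random elements of the space of convex bodies.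

It remains to verify these hypotheses. An isometry of the tangent hyperplane onto `ℝ^d` comes from
orthonormal coordinates of `ℝ^(d+1)` (`exists_coordinates`), and the section of the cone is the hull
of the gnomonic projections of its generators (`profile_posHull`). Slicing the unit ball gives the
density of the gnomonic projection of a uniform point of the half-sphere
(`halfSphereUniform_gnomonic`); after scaling by `1 / n` and multiplication by `n` it becomes
`2 / ω_(d+1) * (n⁻² + ‖y‖²)^(-(d+1)/2)`, which increases to the density of the intensity measure of
the Poisson process. Hence the scaled intensities converge on every measurable set `A`, possibly to
infinity (`tendsto_mul_halfSphereUniform`), and `(1 - q n)^n → exp (-r)` whenever `n * q n → r`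
(`tendsto_one_sub_pow`), which is the void probability of the Poisson process.

Finally, the hull of the Poisson process is compact: the intensity is infinite on each open orthant
and finite off each ball around the origin, so almost surely each orthant contains a point, the
hull of finitely many points is a neighbourhood of the origin, and only finitely many points lie
outside that neighbourhood (`isCompactConvex_convexHull_of_orthant`).
-/

/-! ### Occupancy patterns of random sets -/

/-- The set of those cells `A j` that contain a point of `Ψ`. -/
def occupied {E J : Type*} (A : J → Set E) (Ψ : Set E) : Set J :=
  {j | (Ψ ∩ A j).Nonempty}

/-- A random set is observable if, for each measurable set `A`, it is a (possibly up to null sets)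
measurable event that the random set hits `A`. -/
def IsObservable {Ω E : Type*} [MeasurableSpace Ω] [MeasurableSpace E] (Ψ : Ω → Set E)
    (P : Measure Ω) : Prop :=
  ∀ A : Set E, MeasurableSet A → AEMeasurable (fun ω => (Ψ ω ∩ A).Nonempty) P

section occupancy

variable {E J : Type*}

theorem IsObservable.aemeasurable_occupied [MeasurableSpace E] [Finite J] {Ω : Type*}
    [MeasurableSpace Ω] {Ψ : Ω → Set E}
    {P : Measure Ω} (h : IsObservable Ψ P) {A : J → Set E} (hA : ∀ j, MeasurableSet (A j)) :
    AEMeasurable (fun ω => occupied A (Ψ ω)) P :=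
  aemeasurable_pi_iff.2 fun j => h (A j) (hA j)

theorem occupied_subset_iff {A : J → Set E} {Ψ : Set E} {U : Set J} :
    occupied A Ψ ⊆ U ↔ Ψ ∩ (⋃ j ∈ Uᶜ, A j) = ∅ := by
  rw [Set.eq_empty_iff_forall_notMem]
  constructor
  · rintro h x ⟨hx, hxA⟩
    simp only [Set.mem_iUnion] at hxA
    obtain ⟨j, hj, hxj⟩ := hxA
    exact hj (h ⟨x, hx, hxj⟩)
  · rintro h j ⟨x, hx, hxj⟩
    by_contra hj
    exact h x ⟨hx, Set.mem_biUnion hj hxj⟩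

theorem tendsto_measureReal_singleton_of_subset [Finite J] (μ : ℕ → Measure (Set J))
    [∀ n, IsFiniteMeasure (μ n)] (ν : Measure (Set J)) [IsFiniteMeasure ν]
    (h : ∀ U : Set J, Tendsto (fun n => (μ n).real {V | V ⊆ U}) atTop (𝓝 (ν.real {V | V ⊆ U})))
    (U : Set J) : Tendsto (fun n => (μ n).real {U}) atTop (𝓝 (ν.real {U})) := by
  classical
  have := Fintype.ofFinite J
  induction U using WellFoundedLT.induction with
  | ind U ih =>
    have key : ∀ (ρ : Measure (Set J)) [IsFiniteMeasure ρ],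
        ρ.real {U} = ρ.real {V | V ⊆ U} - ∑ V ∈ Finset.univ.filter (· < U), ρ.real {V} := by
      intro ρ _
      have : ((insert U (Finset.univ.filter (· < U)) : Finset (Set J)) : Set (Set J))
          = {V | V ⊆ U} := by
        ext V
        simp [le_iff_eq_or_lt.symm]
      rw [← this, ← sum_measureReal_singleton, Finset.sum_insert (by simp)]
      ring
    simp_rw [key]
    exact (h U).sub (tendsto_finsetSum _ fun V hV => ih V (by simpa using hV))

theorem integral_comp_eq_sum [Fintype (Set J)] [Finite J] {Ω : Type*} [MeasurableSpace Ω]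
    {P : Measure Ω} [IsProbabilityMeasure P] {S : Ω → Set J} (hS : AEMeasurable S P)
    (g : Set J → ℝ) : ∫ ω, g (S ω) ∂P = ∑ U, (P.map S).real {U} • g U := by
  have := Measure.isProbabilityMeasure_map hS
  rw [← integral_fintype (.of_finite),
    integral_map hS (measurable_of_finite g).aestronglyMeasurable]

/-- The joint law of the occupancy of finitely many cells is determined, by inclusion-exclusion, by
the probabilities that unions of cells are void; this is the version for limits. -/
theorem tendsto_integral_occupied [MeasurableSpace E] [Finite J]
    {Ω : ℕ → Type*} [∀ n, MeasurableSpace (Ω n)]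
    {P : (n : ℕ) → Measure (Ω n)} [∀ n, IsProbabilityMeasure (P n)]
    {Ω' : Type*} [MeasurableSpace Ω'] {P' : Measure Ω'} [IsProbabilityMeasure P']
    {Ψ : (n : ℕ) → Ω n → Set E} {Φ : Ω' → Set E}
    (hΨ : ∀ n, IsObservable (Ψ n) (P n)) (hΦ : IsObservable Φ P')
    (hvoid : ∀ A, MeasurableSet A → Tendsto (fun n => (P n).real {ω | Ψ n ω ∩ A = ∅}) atTop
      (𝓝 (P'.real {ω | Φ ω ∩ A = ∅})))
    {A : J → Set E} (hA : ∀ j, MeasurableSet (A j)) (g : Set J → ℝ) :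
    Tendsto (fun n => ∫ ω, g (occupied A (Ψ n ω)) ∂(P n)) atTop
      (𝓝 (∫ ω, g (occupied A (Φ ω)) ∂P')) := by
  classical
  have := Fintype.ofFinite J
  have hm := fun n => (hΨ n).aemeasurable_occupied hA
  have hm' := hΦ.aemeasurable_occupied hA
  rw [integral_comp_eq_sum hm']
  simp_rw [fun n => integral_comp_eq_sum (hm n) g]
  refine tendsto_finsetSum _ fun U _ => Tendsto.smul_const ?_ _
  have := fun n => Measure.isProbabilityMeasure_map (hm n)
  have := Measure.isProbabilityMeasure_map hm'
  refine tendsto_measureReal_singleton_of_subset _ _ (fun U => ?_) U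
  have hU : MeasurableSet {V : Set J | V ⊆ U} := .of_discrete
  have e : ∀ Ψ : Set E, Ψ ∩ (⋃ j ∈ Uᶜ, A j) = ∅ ↔ occupied A Ψ ⊆ U :=
    fun Ψ => occupied_subset_iff.symm
  convert! hvoid (⋃ j ∈ Uᶜ, A j) (.biUnion (Set.to_countable _) fun j _ => hA j) using 3 with n
  · rw [map_measureReal_apply_of_aemeasurable (hm n) hU]
    simp_rw [e]
    rfl
  · rw [map_measureReal_apply_of_aemeasurable hm' hU]
    simp_rw [e]
    rfl

end occupancy

/-! ### Hausdorff distance of convex hulls -/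

section hull

theorem convexHull_subset_cthickening {E : Type*} [NormedAddCommGroup E] [NormedSpace ℝ E]
    {s t : Set E} {ε : ℝ} (h : ∀ x ∈ s, ∃ y ∈ t, dist x y ≤ ε) :
    convexHull ℝ s ⊆ Metric.cthickening ε (convexHull ℝ t) := by
  refine convexHull_min (fun x hx => ?_) ((convex_convexHull ℝ t).cthickening ε)
  obtain ⟨y, hy, hxy⟩ := h x hx
  exact Metric.mem_cthickening_of_dist_le _ _ _ _ (subset_convexHull ℝ t hy) hxy

variable {d : ℕ}

theorem dist_toConvexBody_convexHull_le {s t : Set (Euc d)} {ε : ℝ} (hε : 0 ≤ ε)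
    (hs : IsCompactConvex (convexHull ℝ s)) (ht : IsCompactConvex (convexHull ℝ t))
    (hst : ∀ x ∈ s, ∃ y ∈ t, dist x y ≤ ε) (hts : ∀ y ∈ t, ∃ x ∈ s, dist y x ≤ ε) :
    dist (toConvexBody (convexHull ℝ s)) (toConvexBody (convexHull ℝ t)) ≤ ε := by
  rw [← ConvexBody.hausdorffDist_coe, coe_toConvexBody hs, coe_toConvexBody ht]
  have aux : ∀ {u v : Set (Euc d)}, (∀ x ∈ u, ∃ y ∈ v, dist x y ≤ ε) →
      ∀ x ∈ convexHull ℝ u, Metric.infDist x (convexHull ℝ v) ≤ ε := by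
    intro u v h x hx
    have := convexHull_subset_cthickening h hx
    exact ENNReal.toReal_le_of_le_ofReal hε (Metric.mem_cthickening_iff.1 this)
  exact Metric.hausdorffDist_le_of_infDist hε (aux hst) (aux hts)

theorem isCompactConvex_convexHull_of_finite {s : Set (Euc d)} (hs : s.Finite)
    (hne : s.Nonempty) : IsCompactConvex (convexHull ℝ s) :=
  ⟨convex_convexHull ℝ s, Set.Finite.isCompact_convexHull ℝ hs, hne.convexHull⟩

/-- The convex hull of the centres of those balls of radius `ε` that contain a point of `Ψ`. -/
noncomputable def netBody {J : Type*} (a : J → Euc d) (ε : ℝ) (Ψ : Set (Euc d)) :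
    ConvexBody (Euc d) :=
  toConvexBody (convexHull ℝ (a '' occupied (fun j => Metric.closedBall (a j) ε) Ψ))

theorem dist_toConvexBody_netBody_le {J : Type*} [Finite J] (a : J → Euc d) {ε : ℝ} (hε : 0 ≤ ε)
    {Ψ : Set (Euc d)} (hΨ : IsCompactConvex (convexHull ℝ Ψ))
    (hcov : Ψ ⊆ ⋃ j, Metric.closedBall (a j) ε) :
    dist (toConvexBody (convexHull ℝ Ψ)) (netBody a ε Ψ) ≤ ε := by
  have hst : ∀ x ∈ Ψ, ∃ y ∈ a '' occupied (fun j => Metric.closedBall (a j) ε) Ψ,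
      dist x y ≤ ε := by
    intro x hx
    obtain ⟨j, hj⟩ := Set.mem_iUnion.1 (hcov hx)
    exact ⟨a j, ⟨j, ⟨x, hx, hj⟩, rfl⟩, hj⟩
  obtain ⟨x, hx⟩ := convexHull_nonempty_iff.1 hΨ.2.2
  obtain ⟨y, hy, -⟩ := hst x hx
  refine dist_toConvexBody_convexHull_le hε hΨ
    (isCompactConvex_convexHull_of_finite (Set.toFinite _) ⟨y, hy⟩) hst ?_
  rintro _ ⟨j, ⟨z, hz, hzj⟩, rfl⟩
  exact ⟨z, hz, by rwa [dist_comm]⟩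

theorem exists_finite_net (R : ℝ) {ε : ℝ} (hε : 0 < ε) :
    ∃ t : Finset (Euc d),
      Metric.closedBall (0 : Euc d) R ⊆ ⋃ a : t, Metric.closedBall (a : Euc d) ε := by
  obtain ⟨t, -, hfin, ht⟩ := Metric.finite_approx_of_totallyBounded
    (isCompact_closedBall (0 : Euc d) R).totallyBounded ε hε
  refine ⟨hfin.toFinset, ht.trans ?_⟩
  refine Set.iUnion₂_subset fun y hy => ?_
  exact Metric.ball_subset_closedBall.trans
    (Set.subset_iUnion (fun a : hfin.toFinset => Metric.closedBall (a : Euc d) ε)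
      ⟨y, by simpa using hy⟩)

end hull

/-! ### Convergence in distribution of convex hulls -/

section convergence

variable {d : ℕ} {Ω : Type*} [MeasurableSpace Ω] {P : Measure Ω} {Ψ : Ω → Set (Euc d)}

theorem IsObservable.aemeasurable_netBody (h : IsObservable Ψ P) {J : Type*} [Finite J]
    (a : J → Euc d) (ε : ℝ) : AEMeasurable (fun ω => netBody a ε (Ψ ω)) P :=
  (measurable_of_finite fun S : Set J => toConvexBody (convexHull ℝ (a '' S))).comp_aemeasurable
    (h.aemeasurable_occupied fun _ => Metric.isClosed_closedBall.measurableSet)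

/-- The convex hull of an observable random set is a measurable random convex body, as a pointwise
limit of bodies that depend only on the occupancy of finitely many balls. -/
theorem IsObservable.aemeasurable_toConvexBody (h : IsObservable Ψ P)
    (hΨ : ∀ᵐ ω ∂P, IsCompactConvex (convexHull ℝ (Ψ ω))) :
    AEMeasurable (fun ω => toConvexBody (convexHull ℝ (Ψ ω))) P := by
  choose t ht using fun k : ℕ =>
    exists_finite_net (d := d) (k : ℝ) (ε := 1 / ((k : ℝ) + 1)) Nat.one_div_pos_of_nat
  refine aemeasurable_of_tendsto_metrizable_ae atTop
    (f := fun k ω => netBody (fun a : t k => (a : Euc d)) (1 / ((k : ℝ) + 1)) (Ψ ω))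
    (fun k => h.aemeasurable_netBody _ _) ?_
  filter_upwards [hΨ] with ω hω
  rw [tendsto_iff_dist_tendsto_zero]
  refine squeeze_zero' (.of_forall fun _ => dist_nonneg) ?_
    tendsto_one_div_add_atTop_nhds_zero_nat
  obtain ⟨R, hR⟩ := hω.2.1.isBounded.subset_closedBall (0 : Euc d)
  obtain ⟨N, hN⟩ := exists_nat_ge R
  filter_upwards [eventually_ge_atTop N] with k hk
  rw [dist_comm]
  refine dist_toConvexBody_netBody_le _ (by positivity) hω ?_
  refine (subset_convexHull ℝ _).trans (hR.trans (.trans ?_ (ht k)))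
  exact Metric.closedBall_subset_closedBall (hN.trans (by exact_mod_cast hk))

/-- A random set with compact convex hull is bounded, hence leaves a large ball with small
probability only. -/
theorem exists_lt_measureReal_inter_compl_closedBall [IsProbabilityMeasure P]
    (hΨ : ∀ᵐ ω ∂P, IsCompactConvex (convexHull ℝ (Ψ ω))) {δ : ℝ} (hδ : 0 < δ) :
    ∃ R : ℝ, 1 - δ < P.real {ω | Ψ ω ∩ (Metric.closedBall 0 R)ᶜ = ∅} := by
  let s : ℕ → Set Ω := fun k => {ω | Ψ ω ∩ (Metric.closedBall 0 (k : ℝ))ᶜ = ∅}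
  have hmono : Monotone s := by
    intro k l hkl ω hω
    simp only [s, Set.mem_ofPred_eq, ← Set.disjoint_iff_inter_eq_empty] at hω ⊢
    exact hω.mono_right (Set.compl_subset_compl.2
      (Metric.closedBall_subset_closedBall (by exact_mod_cast hkl)))
  have hlim := tendsto_measure_iUnion_atTop (μ := P) hmono
  have huniv : P (⋃ k, s k) = 1 := by
    rw [← measure_univ (μ := P)]
    refine measure_congr (eventuallyEq_univ.2 ?_)
    filter_upwards [hΨ] with ω hω
    obtain ⟨R, hR⟩ := hω.2.1.isBounded.subset_closedBall (0 : Euc d)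
    obtain ⟨N, hN⟩ := exists_nat_ge R
    refine Set.mem_iUnion.2 ⟨N, ?_⟩
    refine Set.disjoint_iff_inter_eq_empty.1 (Set.disjoint_compl_right_iff_subset.2 ?_)
    exact (subset_convexHull ℝ _).trans (hR.trans (Metric.closedBall_subset_closedBall hN))
  rw [huniv] at hlim
  have hlim' : Tendsto (fun k => P.real (s k)) atTop (𝓝 1) :=
    (ENNReal.tendsto_toReal ENNReal.one_ne_top).comp hlim
  obtain ⟨k, hk⟩ := (hlim'.eventually (lt_mem_nhds (sub_lt_self 1 hδ))).exists
  exact ⟨k, hk⟩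

/-- Replacing the hull of a random set by the hull of an occupied net changes the expectation of a
bounded Lipschitz function little, if the random set rarely leaves the region covered. -/
theorem abs_integral_toConvexBody_sub_netBody_le [IsProbabilityMeasure P] (h : IsObservable Ψ P)
    (hΨ : ∀ᵐ ω ∂P, IsCompactConvex (convexHull ℝ (Ψ ω))) {J : Type*} [Finite J] (a : J → Euc d)
    {ε R : ℝ} (hε : 0 ≤ ε) (hcov : Metric.closedBall 0 R ⊆ ⋃ j, Metric.closedBall (a j) ε)
    {f : ConvexBody (Euc d) → ℝ} {C : ℝ} (hC : ∀ x y, dist (f x) (f y) ≤ C)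
    {L : ℝ≥0} (hL : LipschitzWith L f) :
    |∫ ω, f (toConvexBody (convexHull ℝ (Ψ ω))) ∂P - ∫ ω, f (netBody a ε (Ψ ω)) ∂P|
      ≤ L * ε + C * (1 - P.real {ω | Ψ ω ∩ (Metric.closedBall 0 R)ᶜ = ∅}) := by
  have hint : ∀ {Z : Ω → ConvexBody (Euc d)}, AEMeasurable Z P →
      Integrable (fun ω => f (Z ω)) P := by
    intro Z hZ
    refine .of_bound (C := C + ‖f 0‖)
      (hL.continuous.measurable.comp_aemeasurable hZ).aestronglyMeasurable (.of_forall fun ω => ?_)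
    calc ‖f (Z ω)‖ ≤ ‖f (Z ω) - f 0‖ + ‖f 0‖ := by
          simpa using norm_add_le (f (Z ω) - f 0) (f 0)
      _ ≤ _ := by gcongr; exact (dist_eq_norm (f (Z ω)) (f 0)) ▸ hC _ _
  have h1 := hint (h.aemeasurable_toConvexBody hΨ)
  have h2 := hint (h.aemeasurable_netBody a ε)
  set B := {ω | Ψ ω ∩ (Metric.closedBall 0 R)ᶜ = ∅} with hB
  have hBm : NullMeasurableSet Bᶜ P := by
    have := (h _ (Metric.isClosed_closedBall (x := (0 : Euc d)) (ε := R)).measurableSet.compl)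
    have := this.nullMeasurableSet_preimage (measurableSet_singleton True)
    convert! this using 1
    ext ω
    simp [hB, Set.nonempty_iff_ne_empty]
  have hC0 : 0 ≤ C := dist_nonneg.trans (hC 0 0)
  rw [← integral_sub h1 h2, ← probReal_compl_eq_one_sub₀ hBm.of_compl]
  calc _ ≤ ∫ ω, (L * ε + Bᶜ.indicator (fun _ => C) ω) ∂P := by
        refine abs_integral_le_integral_abs.trans (integral_mono_ae (h1.sub h2).abs
          ((integrable_const _).add ((integrable_const _).indicator₀ hBm)) ?_)
        filter_upwards [hΨ] with ω hω
        by_cases hωB : ω ∈ B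
        · have : Ψ ω ⊆ Metric.closedBall 0 R := Set.disjoint_compl_right_iff_subset.1
            (Set.disjoint_iff_inter_eq_empty.2 hωB)
          simp only [Set.indicator_of_notMem (Set.notMem_compl_iff.2 hωB), add_zero]
          rw [← Real.dist_eq]
          exact (hL.dist_le_mul _ _).trans (mul_le_mul_of_nonneg_left
            (dist_toConvexBody_netBody_le a hε hω (this.trans hcov)) L.2)
        · rw [Set.indicator_of_mem hωB]
          have := hC (toConvexBody (convexHull ℝ (Ψ ω))) (netBody a ε (Ψ ω))
          rw [Real.dist_eq] at this
          have : (0 : ℝ) ≤ L * ε := by positivity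
          linarith
    _ = _ := by
        rw [integral_add (integrable_const _) ((integrable_const _).indicator₀ hBm),
          integral_indicator₀ hBm]
        simp [mul_comm]

/-- Convergence of void probabilities of random sets with compact convex hulls implies convergence
in distribution of the hulls. -/
theorem tendsto_integral_toConvexBody {Ω : ℕ → Type*} [∀ n, MeasurableSpace (Ω n)]
    {P : (n : ℕ) → Measure (Ω n)} [∀ n, IsProbabilityMeasure (P n)]
    {Ω' : Type*} [MeasurableSpace Ω'] {P' : Measure Ω'} [IsProbabilityMeasure P']
    {Ψ : (n : ℕ) → Ω n → Set (Euc d)} {Φ : Ω' → Set (Euc d)}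
    (hΨ : ∀ n, IsObservable (Ψ n) (P n)) (hΦ : IsObservable Φ P')
    (hΨc : ∀ᶠ n in atTop, ∀ᵐ ω ∂(P n), IsCompactConvex (convexHull ℝ (Ψ n ω)))
    (hΦc : ∀ᵐ ω ∂P', IsCompactConvex (convexHull ℝ (Φ ω)))
    (hvoid : ∀ A, MeasurableSet A → Tendsto (fun n => (P n).real {ω | Ψ n ω ∩ A = ∅}) atTop
      (𝓝 (P'.real {ω | Φ ω ∩ A = ∅})))
    {f : ConvexBody (Euc d) → ℝ} {C : ℝ} (hC : ∀ x y, dist (f x) (f y) ≤ C)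
    {L : ℝ≥0} (hL : LipschitzWith L f) :
    Tendsto (fun n => ∫ ω, f (toConvexBody (convexHull ℝ (Ψ n ω))) ∂(P n)) atTop
      (𝓝 (∫ ω, f (toConvexBody (convexHull ℝ (Φ ω))) ∂P')) := by
  have hC0 : 0 ≤ C := dist_nonneg.trans (hC 0 0)
  rw [Metric.tendsto_atTop']
  intro η hη
  -- Both error terms `L * ε` and `C * δ` of the approximation are made at most `η / 6`.
  set ε := η / (6 * (L + 1)) with hεdef
  set δ := η / (6 * (C + 1)) with hδdef
  have hL0 : (0 : ℝ) ≤ L := L.2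
  have hε : 0 < ε := by positivity
  have hδ : 0 < δ := by positivity
  have hLε : L * ε ≤ η / 6 := by
    rw [hεdef, mul_div_assoc', div_le_div_iff₀ (by positivity) (by positivity)]
    nlinarith
  have hCδ : C * δ ≤ η / 6 := by
    rw [hδdef, mul_div_assoc', div_le_div_iff₀ (by positivity) (by positivity)]
    nlinarith
  obtain ⟨R, hR⟩ := exists_lt_measureReal_inter_compl_closedBall hΦc hδ
  obtain ⟨t, ht⟩ := exists_finite_net (d := d) R hε
  have hbad := (hvoid _ (Metric.isClosed_closedBall (x := (0 : Euc d))
    (ε := R)).measurableSet.compl).eventually (lt_mem_nhds hR)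
  have hocc := tendsto_integral_occupied hΨ hΦ hvoid
    (A := fun a : t => Metric.closedBall (a : Euc d) ε)
    (fun _ => Metric.isClosed_closedBall.measurableSet)
    (fun S => f (toConvexBody (convexHull ℝ ((fun a : t => (a : Euc d)) '' S))))
  have hocc' := hocc.eventually (Metric.ball_mem_nhds _ (by positivity : 0 < η / 3))
  obtain ⟨N, hN⟩ := eventually_atTop.1 (hΨc.and (hbad.and hocc'))
  refine ⟨N, fun n hn => ?_⟩
  obtain ⟨h1, h2, h3⟩ := hN n hn.le
  have e1 := abs_integral_toConvexBody_sub_netBody_le (hΨ n) h1 (fun a : t => (a : Euc d))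
    hε.le ht hC hL
  have e2 := abs_integral_toConvexBody_sub_netBody_le hΦ hΦc (fun a : t => (a : Euc d))
    hε.le ht hC hL
  have e3 : |∫ ω, f (netBody (fun a : t => (a : Euc d)) ε (Ψ n ω)) ∂(P n)
      - ∫ ω, f (netBody (fun a : t => (a : Euc d)) ε (Φ ω)) ∂P'| < η / 3 := h3
  have b1 := mul_le_mul_of_nonneg_left (sub_le_comm.1 h2.le) hC0
  have b2 := mul_le_mul_of_nonneg_left (sub_le_comm.1 hR.le) hC0
  rw [Real.dist_eq]
  rw [abs_le] at e1 e2
  rw [abs_lt] at e3 ⊢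
  constructor <;> linarith [e1.1, e1.2, e2.1, e2.2, e3.1, e3.2]

end convergence

/-! ### Compactness of hulls of sets accumulating at the origin -/

section orthants

variable {d : ℕ}

/-- The open orthant of `ℝ^d` with sign pattern `σ`. -/
def orthant (σ : Fin d → Bool) : Set (Euc d) :=
  {y | ∀ i, 0 < (if σ i then y i else -y i)}

/-- A set of points, one in each open orthant, has the origin in the interior of its hull: a
hyperplane cannot separate a point near the origin from the point in the orthant opposite to the
normal vector. -/
theorem exists_ball_subset_convexHull_range (y : (Fin d → Bool) → Euc d)
    (hy : ∀ σ, y σ ∈ orthant σ) :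
    ∃ ρ > 0, Metric.ball (0 : Euc d) ρ ⊆ convexHull ℝ (Set.range y) := by
  obtain ⟨ρ, hρ, hmin⟩ : ∃ ρ > 0, ∀ p : (Fin d → Bool) × Fin d, ρ ≤ |y p.1 p.2| := by
    have hpos : ∀ p : (Fin d → Bool) × Fin d, 0 < |y p.1 p.2| := by
      intro p
      have := hy p.1 p.2
      split_ifs at this
      · exact abs_pos.2 this.ne'
      · exact abs_pos.2 (by linarith)
    rcases isEmpty_or_nonempty ((Fin d → Bool) × Fin d) with h | h
    · exact ⟨1, one_pos, fun p => h.elim p⟩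
    · obtain ⟨p, hp⟩ := Finite.exists_min fun p : (Fin d → Bool) × Fin d => |y p.1 p.2|
      exact ⟨_, hpos p, hp⟩
  refine ⟨ρ, hρ, fun z hz => ?_⟩
  by_contra hzC
  obtain ⟨f, u, hfz, hfu⟩ := geometric_hahn_banach_point_closed (convex_convexHull ℝ (Set.range y))
    (Set.Finite.isCompact_convexHull ℝ (Set.finite_range y)).isClosed hzC
  let c : Fin d → ℝ := fun i => f (EuclideanSpace.single i 1)
  have hf : ∀ x : Euc d, f x = ∑ i, x i * c i := by
    intro x
    conv_lhs => rw [← (EuclideanSpace.basisFun (Fin d) ℝ).sum_repr x]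
    simp [c]
  let σ : Fin d → Bool := fun i => decide (c i < 0)
  have hσ := hfz.trans (hfu _ (subset_convexHull ℝ _ ⟨σ, rfl⟩))
  rw [hf, hf] at hσ
  refine hσ.not_ge (Finset.sum_le_sum fun i _ => ?_)
  have h1 : |z i| < ρ := (PiLp.norm_apply_le z i).trans_lt (by simpa using hz)
  have h2 := hmin (σ, i)
  have h3 := hy σ i
  rw [abs_lt] at h1
  by_cases hc : c i < 0
  · simp only [σ, hc, decide_true, if_true] at h3
    rw [abs_of_pos h3] at h2
    nlinarith
  · simp only [σ, hc, decide_false] at h3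
    rw [abs_of_neg (by simpa using h3)] at h2
    nlinarith

/-- If a set meets all open orthants and is finite away from the origin, then its hull is the
hull of a finite subset. -/
theorem isCompactConvex_convexHull_of_orthant {Ψ : Set (Euc d)}
    (hΨ : ∀ σ, (Ψ ∩ orthant σ).Nonempty)
    (hfin : ∀ ρ > 0, (Ψ ∩ (Metric.ball 0 ρ)ᶜ).Finite) : IsCompactConvex (convexHull ℝ Ψ) := by
  choose y hyΨ hy using hΨ
  obtain ⟨ρ, hρ, hball⟩ := exists_ball_subset_convexHull_range y hy
  have hF : Set.range y ∪ (Ψ ∩ (Metric.ball 0 ρ)ᶜ) ⊆ Ψ :=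
    Set.union_subset (Set.range_subset_iff.2 hyΨ) Set.inter_subset_left
  have key : convexHull ℝ Ψ = convexHull ℝ (Set.range y ∪ (Ψ ∩ (Metric.ball 0 ρ)ᶜ)) := by
    refine (convexHull_min (fun x hx => ?_) (convex_convexHull ℝ _)).antisymm (convexHull_mono hF)
    by_cases hxρ : x ∈ Metric.ball (0 : Euc d) ρ
    · exact convexHull_mono Set.subset_union_left (hball hxρ)
    · exact subset_convexHull ℝ _ (Or.inr ⟨hx, hxρ⟩)
  rw [key]
  exact isCompactConvex_convexHull_of_finite ((Set.finite_range y).union (hfin ρ hρ))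
    ⟨y fun _ => true, Or.inl ⟨_, rfl⟩⟩

theorem isOpen_orthant (σ : Fin d → Bool) : IsOpen (orthant σ) := by
  simp only [orthant, Set.ofPred_forall]
  refine isOpen_iInter_of_finite fun i => ?_
  cases σ i <;> simp <;> exact isOpen_lt (by fun_prop) (by fun_prop)

theorem orthant_nonempty (σ : Fin d → Bool) : (orthant σ).Nonempty := by
  refine ⟨WithLp.toLp 2 fun i => if σ i then 1 else -1, fun i => ?_⟩
  cases h : σ i <;> simp [h]

theorem smul_mem_orthant_iff {σ : Fin d → Bool} {t : ℝ} (ht : 0 < t) {y : Euc d} :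
    t • y ∈ orthant σ ↔ y ∈ orthant σ := by
  simp only [orthant, Set.mem_ofPred_eq]
  refine forall_congr' fun i => ?_
  cases σ i <;> simp [ht, mul_neg_iff, ht.not_gt]

end orthants

/-! ### The gnomonic projection -/

section gnomonic

variable {d : ℕ}

/-- The isometry `I` determines orthonormal coordinates of `ℝ^(d+1)`, in which `e` is the first
unit vector and `I` forgets the first coordinate. -/
theorem exists_coordinates (e : UnitSphere d) (I : Tan e → Euc d) (hI : Isometry I)
    (hIe : I ⟨e, self_mem_Tan e⟩ = 0) :
    ∃ T : Euc (d + 1) ≃ₗᵢ[ℝ] WithLp 2 (ℝ × Euc d),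
      (∀ x, (T x).fst = inner ℝ x (e : Euc (d + 1))) ∧ ∀ y : Tan e, (T y).snd = I y := by
  have he : ‖(e : Euc (d + 1))‖ = 1 := by simp
  have hee : inner ℝ (e : Euc (d + 1)) (e : Euc (d + 1)) = 1 := by
    rw [real_inner_self_eq_norm_sq, he, one_pow]
  let K := (ℝ ∙ (e : Euc (d + 1)))ᗮ
  have hmem : ∀ v : K, (e : Euc (d + 1)) + v ∈ Tan e := by
    intro v
    have := Submodule.mem_orthogonal_singleton_iff_inner_left.1 v.2
    simp [Tan, this]
  let J : K → Euc d := fun v => I ⟨(e : Euc (d + 1)) + v, hmem v⟩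
  have hJ : Isometry J := by
    refine Isometry.of_dist_eq fun v w => ?_
    rw [hI.dist_eq, Subtype.dist_eq]
    simp [Subtype.dist_eq]
  let A := hJ.affineIsometryOfStrictConvexSpace
  have hJ0 : J 0 = 0 := by simpa [J] using hIe
  have hAL : ∀ v, A.linearIsometry v = J v := by
    intro v
    have := A.map_vadd 0 v
    simpa [A, hJ0] using this.symm
  let p : Euc (d + 1) →ₗ[ℝ] K := K.orthogonalProjectionOnto.toLinearMap
  let B : Euc (d + 1) →ₗ[ℝ] WithLp 2 (ℝ × Euc d) :=
    (WithLp.linearEquiv 2 ℝ (ℝ × Euc d)).symm.toLinearMap ∘ₗ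
      (LinearMap.prod (innerₗ (Euc (d + 1)) (e : Euc (d + 1)))
        (A.linearIsometry.toLinearMap ∘ₗ p))
  have hB1 : ∀ x, (B x).fst = inner ℝ x (e : Euc (d + 1)) := by
    intro x
    rw [real_inner_comm]
    rfl
  have hB2 : ∀ x, (B x).snd = A.linearIsometry (p x) := fun x => rfl
  have hdec : ∀ x, x = (inner ℝ x (e : Euc (d + 1)) : ℝ) • (e : Euc (d + 1)) + (p x : K) := by
    intro x
    have := (ℝ ∙ (e : Euc (d + 1))).starProjection_add_starProjection_orthogonal x
    rw [Submodule.starProjection_unit_singleton ℝ he, real_inner_comm] at this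
    exact this.symm
  have hnorm : ∀ x, ‖B x‖ = ‖x‖ := by
    intro x
    have h0 : inner ℝ (e : Euc (d + 1)) (p x : Euc (d + 1)) = 0 :=
      Submodule.mem_orthogonal_singleton_iff_inner_right.1 (p x).2
    rw [← sq_eq_sq₀ (norm_nonneg _) (norm_nonneg _), WithLp.prod_norm_sq_eq_of_L2, hB1, hB2,
      LinearIsometry.norm_map]
    conv_rhs => rw [hdec x, norm_add_sq_real, inner_smul_left, h0, norm_smul, he]
    simp
  let T := (⟨B, hnorm⟩ : Euc (d + 1) →ₗᵢ[ℝ] WithLp 2 (ℝ × Euc d)).toLinearIsometryEquiv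
    (by rw [(WithLp.linearEquiv 2 ℝ (ℝ × Euc d)).finrank_eq]; simp [add_comm])
  refine ⟨T, hB1, fun y => ?_⟩
  have hy : inner ℝ (y : Euc (d + 1)) (e : Euc (d + 1)) = 1 := by
    have : inner ℝ ((y : Euc (d + 1)) - e) (e : Euc (d + 1)) = 0 := y.2
    rw [inner_sub_left, hee] at this
    linarith
  change (B y).snd = _
  rw [hB2, hAL]
  have := hdec y
  rw [hy, one_smul] at this
  exact congrArg I (Subtype.ext this.symm)

/-- The gnomonic projection in the coordinates `T`: the point where the ray through `x` meets the
hyperplane of points whose first coordinate is one. The value is junk on the equator. -/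
noncomputable def gnomonic (T : Euc (d + 1) ≃ₗᵢ[ℝ] WithLp 2 (ℝ × Euc d)) (x : Euc (d + 1)) :
    Euc d :=
  (T x).fst⁻¹ • (T x).snd

theorem measurable_gnomonic (T : Euc (d + 1) ≃ₗᵢ[ℝ] WithLp 2 (ℝ × Euc d)) :
    Measurable (gnomonic T) := by
  have h1 : Continuous fun x => (T x).fst := by fun_prop
  have h2 : Continuous fun x => (T x).snd := by fun_prop
  exact h1.measurable.inv.smul h2.measurable

theorem mem_posHull_iff {n : ℕ} {x : Fin n → UnitSphere d} {z : Euc (d + 1)} :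
    z ∈ posHull x ↔ ∃ c : Fin n → ℝ, (∀ i, 0 ≤ c i) ∧ ∑ i, c i • (x i : Euc (d + 1)) = z := by
  rw [posHull, SetLike.mem_coe, PointedCone.hull, Submodule.mem_span_range_iff_exists_fun]
  constructor
  · rintro ⟨c, hc⟩
    exact ⟨fun i => c i, fun i => (c i).2, hc⟩
  · rintro ⟨c, hc0, hc⟩
    exact ⟨fun i => ⟨c i, hc0 i⟩, hc⟩

variable {e : UnitSphere d} {I : Tan e → Euc d} {T : Euc (d + 1) ≃ₗᵢ[ℝ] WithLp 2 (ℝ × Euc d)}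

theorem inner_eq_one_of_mem_Tan (y : Tan e) :
    inner ℝ (y : Euc (d + 1)) (e : Euc (d + 1)) = 1 := by
  have h : inner ℝ ((y : Euc (d + 1)) - e) (e : Euc (d + 1)) = 0 := y.2
  have he : ‖(e : Euc (d + 1))‖ = 1 := by simp
  rw [inner_sub_left, real_inner_self_eq_norm_sq, he] at h
  linarith

/-- The section of a cone by the tangent hyperplane is the convex hull of the gnomonic projections
of the generators. -/
theorem profile_posHull (hT1 : ∀ x, (T x).fst = inner ℝ x (e : Euc (d + 1)))
    (hT2 : ∀ y : Tan e, (T y).snd = I y) {n : ℕ} {x : Fin n → UnitSphere d}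
    (hx : ∀ i, 0 < (T (x i)).fst) :
    profile e I (posHull x) = convexHull ℝ (Set.range fun i => gnomonic T (x i)) := by
  have hmem : ∀ z : Euc (d + 1), (T z).fst = 1 → z ∈ Tan e := by
    intro z hz
    have he : ‖(e : Euc (d + 1))‖ = 1 := by simp
    rw [hT1] at hz
    simp [Tan, inner_sub_left, hz, he]
  have hTan : ∀ y : Tan e, (T y).fst = 1 := fun y => (hT1 y).trans (inner_eq_one_of_mem_Tan y)
  -- Both sides consist of the points `(T z).snd`, for `z` in the cone with `(T z).fst = 1`.
  have hiff : ∀ v, v ∈ profile e I (posHull x) ↔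
      ∃ c : Fin n → ℝ, (∀ i, 0 ≤ c i) ∧ ∑ i, c i * (T (x i)).fst = 1 ∧
        ∑ i, c i • (T (x i)).snd = v := by
    have hf : ∀ c : Fin n → ℝ, (T (∑ i, c i • (x i : Euc (d + 1)))).fst
        = ∑ i, c i * (T (x i)).fst := by
      intro c
      simp_rw [hT1, sum_inner, real_inner_smul_left]
    have hs : ∀ c : Fin n → ℝ, (T (∑ i, c i • (x i : Euc (d + 1)))).snd
        = ∑ i, c i • (T (x i)).snd := by
      intro c
      let S : Euc (d + 1) →ₗ[ℝ] Euc d :=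
        (LinearMap.snd ℝ ℝ (Euc d) ∘ₗ (WithLp.linearEquiv 2 ℝ (ℝ × Euc d)).toLinearMap) ∘ₗ
          T.toLinearEquiv.toLinearMap
      have hS : ∀ z, (T z).snd = S z := fun z => rfl
      simp_rw [hS, map_sum, map_smul]
    intro v
    constructor
    · rintro ⟨y, hy, rfl⟩
      obtain ⟨c, hc, hcy⟩ := mem_posHull_iff.1 hy
      refine ⟨c, hc, ?_, ?_⟩
      · rw [← hf, hcy, hTan]
      · rw [← hs, hcy, hT2]
    · rintro ⟨c, hc, hc1, hcv⟩
      refine ⟨⟨∑ i, c i • (x i : Euc (d + 1)), hmem _ ?_⟩, mem_posHull_iff.2 ⟨c, hc, rfl⟩, ?_⟩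
      · rw [hf, hc1]
      · rw [← hT2, hs, hcv]
  ext v
  constructor
  · intro hv
    obtain ⟨c, hc, hc1, rfl⟩ := (hiff v).1 hv
    have : ∑ i, c i • (T (x i)).snd = ∑ i, (c i * (T (x i)).fst) • gnomonic T (x i) := by
      refine Finset.sum_congr rfl fun i _ => ?_
      rw [gnomonic, smul_smul, mul_assoc, mul_inv_cancel₀ (hx i).ne', mul_one]
    rw [this]
    exact (convex_convexHull ℝ _).sum_mem (fun i _ => mul_nonneg (hc i) (hx i).le) hc1
      fun i _ => subset_convexHull ℝ _ ⟨i, rfl⟩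
  · intro hv
    refine convexHull_min ?_ ?_ hv
    · rintro _ ⟨i, rfl⟩
      refine (hiff _).2 ⟨Pi.single i (T (x i)).fst⁻¹, fun j => ?_, ?_, ?_⟩
      · rcases eq_or_ne j i with rfl | hj
        · simpa using (hx j).le
        · simp [hj]
      · simp [Pi.single_apply, (hx i).ne']
      · simp [Pi.single_apply, gnomonic]
    · intro v hv w hw a b ha hb hab
      obtain ⟨c, hc, hc1, hcv⟩ := (hiff v).1 hv
      obtain ⟨c', hc', hc1', hcw⟩ := (hiff w).1 hw
      refine (hiff _).2 ⟨a • c + b • c', fun i => ?_, ?_, ?_⟩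
      · exact add_nonneg (mul_nonneg ha (hc i)) (mul_nonneg hb (hc' i))
      · simp_rw [Pi.add_apply, Pi.smul_apply, smul_eq_mul, add_mul, mul_assoc,
          Finset.sum_add_distrib, ← Finset.mul_sum, hc1, hc1', mul_one, hab]
      · simp_rw [Pi.add_apply, Pi.smul_apply, smul_eq_mul, add_smul, mul_smul,
          Finset.sum_add_distrib, ← Finset.smul_sum, hcv, hcw]

end gnomonic

/-! ### The law of the gnomonic projection of a uniform point of the half-sphere -/

section law

variable {d : ℕ} (T : Euc (d + 1) ≃ₗᵢ[ℝ] WithLp 2 (ℝ × Euc d))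

theorem measurePreserving_coordinates :
    MeasurePreserving (fun x => WithLp.ofLp (T x)) (volume : Measure (Euc (d + 1)))
      ((volume : Measure ℝ).prod (volume : Measure (Euc d))) :=
  (WithLp.volume_preserving_ofLp ℝ (Euc d)).comp T.measurePreserving

theorem measurable_fst_coordinates : Measurable fun x => (T x).fst := by
  have : Continuous fun x => (T x).fst := by fun_prop
  exact this.measurable

theorem gnomonic_smul {r : ℝ} (hr : 0 < r) (x : Euc (d + 1)) :
    gnomonic T (r • x) = gnomonic T x := by
  simp only [gnomonic, map_smul, WithLp.smul_fst, WithLp.smul_snd, smul_eq_mul, mul_inv, smul_smul]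
  rw [mul_right_comm, inv_mul_cancel₀ hr.ne', one_mul]

/-- The part of the unit ball of `ℝ × ℝ^d` in the cone over `{1} × B`. -/
def coneOver (B : Set (Euc d)) : Set (ℝ × Euc d) :=
  {p | 0 < p.1 ∧ p.1 ^ 2 + ‖p.2‖ ^ 2 < 1 ∧ p.1⁻¹ • p.2 ∈ B}

theorem measurableSet_coneOver {B : Set (Euc d)} (hB : MeasurableSet B) :
    MeasurableSet (coneOver B) := by
  refine (measurableSet_lt measurable_const measurable_fst).inter
    ((measurableSet_lt (f := fun p : ℝ × Euc d => p.1 ^ 2 + ‖p.2‖ ^ 2) (by fun_prop)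
      measurable_const).inter ?_)
  exact (measurable_fst.inv.smul measurable_snd) hB

theorem volume_section_coneOver {B : Set (Euc d)} {s : ℝ} (hs : 0 < s) :
    volume (Prod.mk s ⁻¹' coneOver B) = ENNReal.ofReal (s ^ d) *
      volume {y ∈ B | s < 1 / √(1 + ‖y‖ ^ 2)} := by
  have : Prod.mk s ⁻¹' coneOver B = s • {y ∈ B | s < 1 / √(1 + ‖y‖ ^ 2)} := by
    ext w
    rw [Set.mem_smul_set_iff_inv_smul_mem₀ hs.ne']
    simp only [coneOver, Set.mem_preimage, Set.mem_ofPred_eq, hs, true_and]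
    rw [and_comm]
    refine and_congr_right fun _ => ?_
    rw [lt_div_iff₀ (by positivity), norm_smul, norm_inv, Real.norm_of_nonneg hs.le]
    rw [← Real.sqrt_sq hs.le, ← Real.sqrt_mul (by positivity), Real.sqrt_sq hs.le,
      Real.sqrt_lt' one_pos]
    have : s ^ 2 * (1 + (s⁻¹ * ‖w‖) ^ 2) = s ^ 2 + ‖w‖ ^ 2 := by
      field_simp
    rw [this, one_pow]
  rw [this, Measure.addHaar_smul]
  simp [abs_of_pos hs]

theorem lintegral_pow_Ioi {r : ℝ} (hr : 0 ≤ r) :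
    ∫⁻ s in Set.Ioi (0 : ℝ), (Set.Iio r).indicator (fun s => ENNReal.ofReal (s ^ d)) s
      = ENNReal.ofReal (r ^ (d + 1) / (d + 1)) := by
  rw [setLIntegral_indicator measurableSet_Iio, Set.inter_comm, Set.Ioi_inter_Iio,
    restrict_Ioo_eq_restrict_Ioc,
    ← ofReal_integral_eq_lintegral_ofReal, ← intervalIntegral.integral_of_le hr, integral_pow]
  · simp
  · exact (continuous_pow d).integrableOn_Ioc
  · exact (ae_restrict_iff' measurableSet_Ioc).2 (.of_forall fun s hs => pow_nonneg hs.1.le _)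

/-- Integration over the slices of constant first coordinate. -/
theorem prod_volume_coneOver {B : Set (Euc d)} (hB : MeasurableSet B) :
    ((volume : Measure ℝ).prod (volume : Measure (Euc d))) (coneOver B)
      = ∫⁻ y in B, ENNReal.ofReal ((1 / √(1 + ‖y‖ ^ 2)) ^ (d + 1) / (d + 1)) := by
  rw [Measure.prod_apply (measurableSet_coneOver hB)]
  have h0 : ∀ s, s ∉ Set.Ioi (0 : ℝ) → volume (Prod.mk s ⁻¹' coneOver B) = 0 := by
    intro s hs
    have : Prod.mk s ⁻¹' coneOver B = ∅ := by
      ext w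
      simp only [coneOver, Set.mem_preimage, Set.mem_ofPred_eq, Set.mem_empty_iff_false, iff_false]
      exact fun h => hs h.1
    rw [this, measure_empty]
  have hrm : Measurable fun y : Euc d => 1 / √(1 + ‖y‖ ^ 2) := by fun_prop
  rw [← setLIntegral_eq_of_support_subset (s := Set.Ioi (0 : ℝ))
    (fun s hs => by_contra fun h => hs (h0 s h))]
  have h1 : ∀ s ∈ Set.Ioi (0 : ℝ), volume (Prod.mk s ⁻¹' coneOver B) =
      ∫⁻ y in B, (Set.Iio (1 / √(1 + ‖y‖ ^ 2))).indicator (fun s => ENNReal.ofReal (s ^ d)) s := by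
    intro s hs
    have hm : MeasurableSet {y : Euc d | s < 1 / √(1 + ‖y‖ ^ 2)} :=
      measurableSet_lt measurable_const hrm
    rw [volume_section_coneOver hs]
    have : ∀ y : Euc d,
        (Set.Iio (1 / √(1 + ‖y‖ ^ 2))).indicator (fun s => ENNReal.ofReal (s ^ d)) s
        = {y : Euc d | s < 1 / √(1 + ‖y‖ ^ 2)}.indicator (fun _ => ENNReal.ofReal (s ^ d)) y :=
      fun y => rfl
    simp_rw [this]
    rw [setLIntegral_indicator hm, setLIntegral_const, Set.inter_comm]
    rfl
  rw [setLIntegral_congr_fun measurableSet_Ioi h1, lintegral_lintegral_swap]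
  · refine lintegral_congr fun y => lintegral_pow_Ioi (by positivity)
  · have hm : MeasurableSet {p : ℝ × Euc d | p.1 < 1 / √(1 + ‖p.2‖ ^ 2)} :=
      measurableSet_lt measurable_fst (hrm.comp measurable_snd)
    exact Measurable.aemeasurable (Measurable.indicator (by fun_prop) hm)

/-- The measure on the sphere in terms of the volume of the corresponding sectors. -/
theorem toSphere_apply_eq_volume {s : Set (UnitSphere d)} (hs : MeasurableSet s)
    {t : Set (Euc (d + 1))} (h0 : (0 : Euc (d + 1)) ∉ t)
    (hst : ∀ x : UnitSphere d, x ∈ s ↔ (x : Euc (d + 1)) ∈ t)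
    (ht : ∀ (r : ℝ) (x : Euc (d + 1)), 0 < r → (r • x ∈ t ↔ x ∈ t)) :
    (volume : Measure (Euc (d + 1))).toSphere s
      = (d + 1 : ℕ) * volume (t ∩ Metric.ball 0 1) := by
  rw [Measure.toSphere_apply' _ hs, finrank_euclideanSpace_fin]
  congr 2
  ext v
  constructor
  · rintro ⟨r, ⟨hr0, hr1⟩, _, ⟨x, hx, rfl⟩, rfl⟩
    refine ⟨(ht r x hr0).2 ((hst x).1 hx), ?_⟩
    simpa [norm_smul, abs_of_pos hr0] using hr1
  · rintro ⟨hv, hv1⟩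
    have hv0 : v ≠ 0 := fun h => h0 (h ▸ hv)
    have hn : 0 < ‖v‖ := norm_pos_iff.2 hv0
    refine ⟨‖v‖, ⟨hn, by simpa using hv1⟩, ‖v‖⁻¹ • v,
      ⟨⟨‖v‖⁻¹ • v, by simp [norm_smul, hn.ne']⟩, ?_, rfl⟩, ?_⟩
    · exact (hst _).2 ((ht _ _ (inv_pos.2 hn)).2 hv)
    · simp [smul_smul, hn.ne']

theorem toSphere_gnomonic {B : Set (Euc d)} (hB : MeasurableSet B) :
    (volume : Measure (Euc (d + 1))).toSphere
        {x : UnitSphere d | 0 < (T x).fst ∧ gnomonic T x ∈ B}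
      = ∫⁻ y in B, ENNReal.ofReal ((1 / √(1 + ‖y‖ ^ 2)) ^ (d + 1)) := by
  have hm : MeasurableSet {x : Euc (d + 1) | 0 < (T x).fst ∧ gnomonic T x ∈ B} :=
    (measurableSet_lt measurable_const (measurable_fst_coordinates T)).inter
      (measurable_gnomonic T hB)
  rw [toSphere_apply_eq_volume (t := {x | 0 < (T x).fst ∧ gnomonic T x ∈ B})
    (s := {x : UnitSphere d | 0 < (T x).fst ∧ gnomonic T x ∈ B}) (measurable_subtype_coe hm)
    (by simp) (fun _ => Iff.rfl)]
  · have : {x | 0 < (T x).fst ∧ gnomonic T x ∈ B} ∩ Metric.ball 0 1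
        = (fun x => WithLp.ofLp (T x)) ⁻¹' coneOver B := by
      ext x
      have h1 : (x ∈ Metric.ball (0 : Euc (d + 1)) 1) ↔ (T x).fst ^ 2 + ‖(T x).snd‖ ^ 2 < 1 := by
        have := WithLp.prod_norm_sq_eq_of_L2 (T x)
        rw [T.norm_map, Real.norm_eq_abs, sq_abs] at this
        rw [← this, mem_ball_zero_iff, sq_lt_one_iff₀ (norm_nonneg _)]
      simp only [Set.mem_inter_iff, h1]
      constructor
      · rintro ⟨⟨h, h'⟩, h''⟩
        exact ⟨h, h'', h'⟩
      · rintro ⟨h, h'', h'⟩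
        exact ⟨⟨h, h'⟩, h''⟩
    rw [this, (measurePreserving_coordinates T).measure_preimage
      (measurableSet_coneOver hB).nullMeasurableSet, prod_volume_coneOver hB,
      ← lintegral_const_mul _ (by fun_prop)]
    refine lintegral_congr fun y => ?_
    rw [← ENNReal.ofReal_natCast, ← ENNReal.ofReal_mul (by positivity)]
    congr 1
    push_cast
    field_simp
  · intro r x hr
    simp [gnomonic_smul T hr, hr]

theorem toSphere_equator :
    (volume : Measure (Euc (d + 1))).toSphere {x : UnitSphere d | (T x).fst = 0} = 0 := by
  -- The origin is removed, as it lies in no sector.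
  rw [toSphere_apply_eq_volume (s := {x : UnitSphere d | (T x).fst = 0})
    (t := {x | (T x).fst = 0 ∧ x ≠ 0})
    (measurable_subtype_coe (measurable_fst_coordinates T (measurableSet_singleton 0)))
    (by simp)]
  · have h : volume ((fun x => WithLp.ofLp (T x)) ⁻¹' ({0} ×ˢ Set.univ)) = 0 := by
      rw [(measurePreserving_coordinates T).measure_preimage
        ((measurableSet_singleton _).prod .univ).nullMeasurableSet, Measure.prod_prod]
      simp
    rw [measure_mono_null (fun x hx => ?_) h, mul_zero]
    exact ⟨hx.1.1, trivial⟩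
  · intro x
    have : (x : Euc (d + 1)) ≠ 0 := ne_zero_of_mem_unit_sphere x
    simp [this]
  · intro r x hr
    simp [hr.ne']

theorem toSphere_univ :
    (volume : Measure (Euc (d + 1))).toSphere Set.univ = ENNReal.ofReal (sphereArea (d + 1)) := by
  rw [Measure.toSphere_apply_univ, EuclideanSpace.volume_ball, finrank_euclideanSpace_fin,
    Fintype.card_fin, ENNReal.ofReal_one, one_pow, one_mul, ← ENNReal.ofReal_natCast,
    ← ENNReal.ofReal_mul (by positivity), sphereArea]
  congr 1
  rw [Real.Gamma_add_one (by positivity), Real.sqrt_eq_rpow, ← Real.rpow_natCast,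
    ← Real.rpow_mul Real.pi_pos.le, one_div_mul_eq_div]
  field_simp

theorem sphereArea_pos (k : ℕ) (hk : 0 < k) : 0 < sphereArea k := by
  have : 0 < Real.Gamma ((k : ℝ) / 2) := Real.Gamma_pos_of_pos (by positivity)
  unfold sphereArea
  positivity

/-- The half-sphere has half the area of the sphere: reflect it and discard the equator. -/
theorem toSphere_half_sphere :
    (volume : Measure (Euc (d + 1))).toSphere {x : UnitSphere d | 0 ≤ (T x).fst}
      = ENNReal.ofReal (sphereArea (d + 1) / 2) := by
  set μ := (volume : Measure (Euc (d + 1))).toSphere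
  have hf : Measurable fun x : UnitSphere d => (T x).fst :=
    (measurable_fst_coordinates T).comp measurable_subtype_coe
  have hpos : MeasurableSet {x : UnitSphere d | 0 < (T x).fst} :=
    measurableSet_lt measurable_const hf
  have hneg : MeasurableSet {x : UnitSphere d | (T x).fst < 0} :=
    measurableSet_lt hf measurable_const
  have hsymm : μ {x : UnitSphere d | (T x).fst < 0} = μ {x : UnitSphere d | 0 < (T x).fst} := by
    rw [toSphere_apply_eq_volume (t := {x | (T x).fst < 0}) hneg (by simp) (fun _ => Iff.rfl),
      toSphere_apply_eq_volume (t := {x | 0 < (T x).fst}) hpos (by simp) (fun _ => Iff.rfl),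
      ← Measure.measure_neg]
    · congr 2
      ext x
      simp
    · intro r x hr
      simp [hr]
    · intro r x hr
      simp [mul_neg_iff, hr, hr.not_gt]
  have hge : μ {x : UnitSphere d | 0 ≤ (T x).fst} = μ {x : UnitSphere d | 0 < (T x).fst} := by
    refine measure_congr ?_
    have := measure_eq_zero_iff_ae_notMem.1 (toSphere_equator T)
    filter_upwards [this] with x hx
    refine propext ⟨fun h => lt_of_le_of_ne h (Ne.symm hx), le_of_lt⟩
  have hsum : μ {x : UnitSphere d | 0 ≤ (T x).fst} + μ {x : UnitSphere d | (T x).fst < 0}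
      = μ Set.univ := by
    rw [← measure_union _ hneg]
    · congr 1
      ext x
      simp [le_or_gt]
    · refine Set.disjoint_left.2 fun x hx hx' => ?_
      exact (not_lt.2 (show 0 ≤ (T (x : Euc (d + 1))).fst from hx)) hx'
  rw [hsymm, ← hge, toSphere_univ, ← two_mul] at hsum
  rw [ENNReal.ofReal_div_of_pos two_pos, ← hsum, ENNReal.ofReal_ofNat, mul_comm,
    ENNReal.mul_div_cancel_right (by simp) (by simp)]

variable {T} {e : UnitSphere d}

theorem ae_fst_pos (hT : ∀ x, (T x).fst = inner ℝ x (e : Euc (d + 1))) :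
    ∀ᵐ x : UnitSphere d ∂(halfSphereUniform e), 0 < (T x).fst := by
  have hf : Measurable fun x : UnitSphere d => (T x).fst :=
    (measurable_fst_coordinates T).comp measurable_subtype_coe
  unfold halfSphereUniform
  simp_rw [← hT]
  have h1 := ProbabilityTheory.ae_cond_mem (μ := (volume : Measure (Euc (d + 1))).toSphere)
    (measurableSet_le measurable_const hf : MeasurableSet {x : UnitSphere d | 0 ≤ (T x).fst})
  have h0 : ∀ᵐ x : UnitSphere d ∂(volume : Measure (Euc (d + 1))).toSphere, ¬ (T x).fst = 0 :=
    measure_eq_zero_iff_ae_notMem.1 (toSphere_equator T)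
  have h2 := (cond_absolutelyContinuous (μ := (volume : Measure (Euc (d + 1))).toSphere)
    (s := {x : UnitSphere d | 0 ≤ (T x).fst})).ae_le h0
  filter_upwards [h1, h2] with x hx hx'
  exact lt_of_le_of_ne hx (Ne.symm hx')

/-- The gnomonic projection of a uniform point of the half-sphere has a multivariate Cauchy
(beta prime) distribution. -/
theorem halfSphereUniform_gnomonic (hT : ∀ x, (T x).fst = inner ℝ x (e : Euc (d + 1)))
    {B : Set (Euc d)} (hB : MeasurableSet B) :
    halfSphereUniform e {x | gnomonic T x ∈ B} = ∫⁻ y in B,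
      ENNReal.ofReal (2 / sphereArea (d + 1) * (1 / √(1 + ‖y‖ ^ 2)) ^ (d + 1)) := by
  have hf : Measurable fun x : UnitSphere d => (T x).fst :=
    (measurable_fst_coordinates T).comp measurable_subtype_coe
  have hω := sphereArea_pos (d + 1) d.succ_pos
  have h1 : halfSphereUniform e {x | gnomonic T x ∈ B}
      = halfSphereUniform e {x | 0 < (T x).fst ∧ gnomonic T x ∈ B} := by
    refine measure_congr ?_
    filter_upwards [ae_fst_pos hT] with x hx
    exact propext ⟨fun h => ⟨hx, h⟩, fun h => h.2⟩
  rw [h1]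
  unfold halfSphereUniform
  simp_rw [← hT]
  rw [cond_apply (measurableSet_le measurable_const hf), toSphere_half_sphere,
    Set.inter_eq_self_of_subset_right (fun x hx => hx.1.le), toSphere_gnomonic T hB,
    ← ENNReal.ofReal_inv_of_pos (by positivity), inv_div, ← lintegral_const_mul _ (by fun_prop)]
  refine lintegral_congr fun y => ?_
  rw [ENNReal.ofReal_mul (by positivity)]

end law

/-! ### The intensity measure as a limit of scaled binomial intensities -/

section intensity

variable {d : ℕ}

theorem lintegral_eq_pow_mul_lintegral_comp_smul {f : Euc d → ℝ≥0∞} (hf : Measurable f) {r : ℝ}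
    (hr : 0 < r) : ∫⁻ y, f y = ENNReal.ofReal (r ^ d) * ∫⁻ y, f (r • y) := by
  have h := Measure.map_addHaar_smul (volume : Measure (Euc d)) hr.ne'
  rw [← lintegral_map hf (measurable_const_smul r), h, lintegral_smul_measure, smul_eq_mul,
    ← mul_assoc, ← ENNReal.ofReal_mul (by positivity), finrank_euclideanSpace_fin,
    abs_of_pos (by positivity), mul_inv_cancel₀ (by positivity), ENNReal.ofReal_one, one_mul]

variable {T : Euc (d + 1) ≃ₗᵢ[ℝ] WithLp 2 (ℝ × Euc d)} {e : UnitSphere d}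

theorem mul_halfSphereUniform_smul_gnomonic
    (hT : ∀ x, (T x).fst = inner ℝ x (e : Euc (d + 1)))
    {A : Set (Euc d)} (hA : MeasurableSet A) {n : ℕ} (hn : 1 ≤ n) :
    n * halfSphereUniform e {x | (n : ℝ)⁻¹ • gnomonic T x ∈ A} = ∫⁻ y in A, ENNReal.ofReal
      (2 / sphereArea (d + 1) * (1 / √(((n : ℝ)⁻¹) ^ 2 + ‖y‖ ^ 2)) ^ (d + 1)) := by
  have hn0 : (0 : ℝ) < n := by exact_mod_cast hn
  have hm : MeasurableSet ((fun y : Euc d => (n : ℝ)⁻¹ • y) ⁻¹' A) := measurable_const_smul _ hA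
  have hω := sphereArea_pos (d + 1) d.succ_pos
  rw [show {x : UnitSphere d | (n : ℝ)⁻¹ • gnomonic T x ∈ A}
    = {x : UnitSphere d | gnomonic T x ∈ (fun y : Euc d => (n : ℝ)⁻¹ • y) ⁻¹' A} from rfl,
    halfSphereUniform_gnomonic hT hm, ← lintegral_indicator hm,
    lintegral_eq_pow_mul_lintegral_comp_smul (Measurable.indicator (by fun_prop) hm) hn0,
    ← lintegral_indicator hA, ← ENNReal.ofReal_natCast, ← mul_assoc,
    ← ENNReal.ofReal_mul hn0.le, ← lintegral_const_mul _ ?_]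
  · refine lintegral_congr fun y => ?_
    have hiff : (n : ℝ) • y ∈ (fun y : Euc d => (n : ℝ)⁻¹ • y) ⁻¹' A ↔ y ∈ A := by
      simp [smul_smul, hn0.ne']
    by_cases hy : y ∈ A
    · rw [Set.indicator_of_mem (hiff.2 hy), Set.indicator_of_mem hy,
        ← ENNReal.ofReal_mul (by positivity)]
      congr 1
      have : √(1 + ‖(n : ℝ) • y‖ ^ 2) = n * √(((n : ℝ)⁻¹) ^ 2 + ‖y‖ ^ 2) := by
        conv_rhs => rw [← Real.sqrt_sq hn0.le, ← Real.sqrt_mul (by positivity)]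
        rw [Real.sqrt_sq hn0.le, norm_smul, Real.norm_of_nonneg hn0.le]
        congr 1
        field_simp
      rw [this, ← one_div_mul_one_div, mul_pow]
      have h2 : (n : ℝ) * n ^ d * ((1 / (n : ℝ)) ^ (d + 1)) = 1 := by
        rw [← pow_succ', ← mul_pow, mul_one_div_cancel hn0.ne', one_pow]
      linear_combination (2 / sphereArea (d + 1)
        * (1 / √(((n : ℝ)⁻¹) ^ 2 + ‖y‖ ^ 2)) ^ (d + 1)) * h2
    · rw [Set.indicator_of_notMem (hiff.not.2 hy), Set.indicator_of_notMem hy, mul_zero]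
  · exact (Measurable.indicator (by fun_prop) hm).comp (measurable_const_smul (n : ℝ))

theorem poissonIntensity_preimage_coe (hd : 1 ≤ d) {A : Set (Euc d)} (hA : MeasurableSet A) :
    poissonIntensity d ((fun y : PuncturedEuc d => (y : Euc d)) ⁻¹' A) = ∫⁻ y in A,
      ENNReal.ofReal (2 / sphereArea (d + 1) * (1 / ‖y‖ ^ (d + 1))) := by
  have : Nonempty (Fin d) := ⟨⟨0, hd⟩⟩
  have hs : MeasurableSet {y : Euc d | y ≠ 0} := (measurableSet_singleton 0).compl
  have hemb : MeasurableEmbedding (fun y : PuncturedEuc d => (y : Euc d)) :=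
    MeasurableEmbedding.subtype_coe hs
  have hae : (volume : Measure (Euc d)).restrict (Set.range fun y : PuncturedEuc d => (y : Euc d))
      = volume := by
    refine Measure.restrict_eq_self_of_ae_mem ?_
    filter_upwards [Measure.ae_ne volume (0 : Euc d)] with y hy
    exact ⟨⟨y, hy⟩, rfl⟩
  rw [poissonIntensity, withDensity_apply _ (hemb.measurable hA)]
  conv_rhs => rw [← hae, ← hemb.map_comap]
  rw [hemb.restrict_map, hemb.lintegral_map]

/-- The densities of the scaled intensities increase to that of the limit. -/
theorem tendsto_mul_halfSphereUniform (hd : 1 ≤ d)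
    (hT : ∀ x, (T x).fst = inner ℝ x (e : Euc (d + 1))) {A : Set (Euc d)} (hA : MeasurableSet A) :
    Tendsto (fun n : ℕ => (n : ℝ≥0∞) * halfSphereUniform e {x | (n : ℝ)⁻¹ • gnomonic T x ∈ A})
      atTop (𝓝 (poissonIntensity d ((fun y : PuncturedEuc d => (y : Euc d)) ⁻¹' A))) := by
  have : Nonempty (Fin d) := ⟨⟨0, hd⟩⟩
  have hω := sphereArea_pos (d + 1) d.succ_pos
  rw [poissonIntensity_preimage_coe hd hA, ← tendsto_add_atTop_iff_nat 1]
  simp_rw [fun n : ℕ => mul_halfSphereUniform_smul_gnomonic hT hA (Nat.le_add_left 1 n)]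
  refine lintegral_tendsto_of_tendsto_of_monotone (fun n => by fun_prop) ?_ ?_
  · refine .of_forall fun y m n hmn => ENNReal.ofReal_le_ofReal ?_
    have : (((n + 1 : ℕ) : ℝ)⁻¹) ≤ ((m + 1 : ℕ) : ℝ)⁻¹ := by
      gcongr
    have hp : (0 : ℝ) < (((n + 1 : ℕ) : ℝ)⁻¹) := by positivity
    gcongr
  · refine ae_restrict_of_ae ?_
    filter_upwards [Measure.ae_ne volume (0 : Euc d)] with y hy
    have hy' : ‖y‖ ≠ 0 := norm_ne_zero_iff.2 hy
    refine ENNReal.tendsto_ofReal (Tendsto.const_mul _ ?_)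
    have h1 : Tendsto (fun n : ℕ => (((n + 1 : ℕ) : ℝ)⁻¹) ^ 2 + ‖y‖ ^ 2) atTop (𝓝 (‖y‖ ^ 2)) := by
      have := (((tendsto_inv_atTop_nhds_zero_nat (𝕜 := ℝ)).comp (tendsto_add_atTop_nat 1)).pow
        2).add_const (‖y‖ ^ 2)
      simpa using this
    have h2 := h1.sqrt
    rw [Real.sqrt_sq (norm_nonneg y)] at h2
    simpa [one_div] using (h2.inv₀ hy').pow (d + 1)

theorem isProbabilityMeasure_halfSphereUniform
    (hT : ∀ x, (T x).fst = inner ℝ x (e : Euc (d + 1))) :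
    IsProbabilityMeasure (halfSphereUniform e) := by
  refine cond_isProbabilityMeasure ?_
  simp_rw [← hT]
  rw [toSphere_half_sphere]
  simpa using sphereArea_pos (d + 1) d.succ_pos

/-- Scaling a point does not move it out of an open cone, so the scaled intensities of the cone are
`n` times a positive constant, and their limit is infinite. -/
theorem poissonIntensity_orthant (hd : 1 ≤ d)
    (hT : ∀ x, (T x).fst = inner ℝ x (e : Euc (d + 1))) (σ : Fin d → Bool) :
    poissonIntensity d ((fun y : PuncturedEuc d => (y : Euc d)) ⁻¹' orthant σ) = ∞ := by
  have hm := (isOpen_orthant σ).measurableSet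
  have hω := sphereArea_pos (d + 1) d.succ_pos
  have hlim := tendsto_mul_halfSphereUniform hd hT hm
  set q := halfSphereUniform e {x | gnomonic T x ∈ orthant σ} with hq
  have hpos : q ≠ 0 := by
    rw [hq, halfSphereUniform_gnomonic hT hm]
    refine (setLIntegral_pos_iff (by fun_prop)).2 ?_ |>.ne'
    rw [Set.inter_eq_self_of_subset_right]
    · exact (isOpen_orthant σ).measure_pos _ (orthant_nonempty σ)
    · intro y _
      simp only [Function.mem_support, ne_eq, ENNReal.ofReal_eq_zero, not_le]
      positivity
  refine tendsto_nhds_unique hlim ?_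
  have h2 : Tendsto (fun n : ℕ => (n : ℝ≥0∞) * q) atTop (𝓝 (∞ * q)) :=
    ENNReal.Tendsto.mul_const ENNReal.tendsto_nat_nhds_top (Or.inr (by
      have := isProbabilityMeasure_halfSphereUniform hT
      exact measure_ne_top _ _))
  rw [ENNReal.top_mul hpos] at h2
  refine h2.congr' ?_
  filter_upwards [eventually_ge_atTop 1] with n hn
  have hn0 : (0 : ℝ) < n := by exact_mod_cast hn
  simp_rw [smul_mem_orthant_iff (inv_pos.2 hn0), hq]

theorem poissonIntensity_compl_ball_lt_top (hd : 1 ≤ d) {ρ : ℝ} (hρ : 0 < ρ) :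
    poissonIntensity d ((fun y : PuncturedEuc d => (y : Euc d)) ⁻¹' (Metric.ball 0 ρ)ᶜ) < ∞ := by
  have hω := sphereArea_pos (d + 1) d.succ_pos
  rw [poissonIntensity_preimage_coe hd Metric.isOpen_ball.measurableSet.compl]
  have hfin : ∫⁻ y : Euc d, ENNReal.ofReal ((1 + ‖y‖) ^ (-((d + 1 : ℕ) : ℝ))) < ∞ :=
    finite_integral_one_add_norm (by simp)
  set K := 2 / sphereArea (d + 1) * ((1 + ρ) / ρ) ^ (d + 1) with hK
  -- Outside the ball, `‖y‖` is comparable to `1 + ‖y‖`.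
  have hle : ∀ y ∈ (Metric.ball (0 : Euc d) ρ)ᶜ,
      ENNReal.ofReal (2 / sphereArea (d + 1) * (1 / ‖y‖ ^ (d + 1)))
      ≤ ENNReal.ofReal K * ENNReal.ofReal ((1 + ‖y‖) ^ (-((d + 1 : ℕ) : ℝ))) := by
    intro y hy
    have hy' : ρ ≤ ‖y‖ := by simpa using hy
    have hy0 : 0 < ‖y‖ := hρ.trans_le hy'
    rw [← ENNReal.ofReal_mul (by positivity), Real.rpow_neg (by positivity), Real.rpow_natCast, hK,
      mul_assoc, ← inv_pow, ← mul_pow, one_div, ← inv_pow]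
    refine ENNReal.ofReal_le_ofReal ?_
    gcongr
    rw [inv_le_iff_one_le_mul₀ hy0, ← div_eq_mul_inv, div_div, div_mul_eq_mul_div,
      one_le_div (by positivity)]
    nlinarith
  calc _ ≤ ∫⁻ y in (Metric.ball (0 : Euc d) ρ)ᶜ,
        ENNReal.ofReal K * ENNReal.ofReal ((1 + ‖y‖) ^ (-((d + 1 : ℕ) : ℝ))) :=
        setLIntegral_mono' Metric.isOpen_ball.measurableSet.compl hle
    _ ≤ ∫⁻ y : Euc d, ENNReal.ofReal K * ENNReal.ofReal ((1 + ‖y‖) ^ (-((d + 1 : ℕ) : ℝ))) :=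
        setLIntegral_le_lintegral _ _
    _ < ∞ := by
        rw [lintegral_const_mul' _ _ ENNReal.ofReal_ne_top]
        exact ENNReal.mul_lt_top ENNReal.ofReal_lt_top hfin

end intensity

/-! ### Void probabilities -/

section void

theorem extPoisson_real_zero (r : ℝ≥0∞) :
    (extPoisson r).real {0} = if r = ∞ then 0 else Real.exp (-r.toReal) := by
  unfold extPoisson
  split_ifs with h
  · simp [measureReal_def]
  · rw [map_measureReal_apply (measurable_of_countable _) (measurableSet_singleton _)]
    have : (fun k : ℕ => (k : ℕ∞)) ⁻¹' {0} = {0} := by ext; simp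
    rw [this, poissonMeasure_real_singleton]
    simp [ENNReal.toReal]

theorem extPoisson_top {r : ℝ≥0∞} (hr : r ≠ ∞) : extPoisson r {⊤} = 0 := by
  rw [extPoisson, if_neg hr, Measure.map_apply (measurable_of_countable _)
    (measurableSet_singleton _)]
  have : (fun k : ℕ => (k : ℕ∞)) ⁻¹' {⊤} = ∅ := by ext; simp
  rw [this, measure_empty]

/-- The Poisson limit theorem for void probabilities, including the case of infinite intensity. -/
theorem tendsto_one_sub_pow {q : ℕ → ℝ≥0∞} (hq : ∀ n, q n ≤ 1) {r : ℝ≥0∞}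
    (h : Tendsto (fun n : ℕ => (n : ℝ≥0∞) * q n) atTop (𝓝 r)) :
    Tendsto (fun n : ℕ => (1 - (q n).toReal) ^ n) atTop (𝓝 ((extPoisson r).real {0})) := by
  have hq' : ∀ n, (q n).toReal ≤ 1 := fun n => by
    simpa using ENNReal.toReal_mono ENNReal.one_ne_top (hq n)
  rw [extPoisson_real_zero]
  split_ifs with hr
  · subst hr
    have hne : ∀ n : ℕ, (n : ℝ≥0∞) * q n ≠ ∞ := fun n =>
      ENNReal.mul_ne_top (ENNReal.natCast_ne_top n) ((hq n).trans_lt ENNReal.one_lt_top).ne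
    have h' : Tendsto (fun n : ℕ => (n : ℝ) * (q n).toReal) atTop atTop := by
      refine tendsto_atTop.2 fun b => ?_
      filter_upwards [h.eventually (lt_mem_nhds (ENNReal.ofReal_lt_top (r := b)))] with n hn
      simpa using (ENNReal.ofReal_le_iff_le_toReal (hne n)).1 hn.le
    refine squeeze_zero (fun n => pow_nonneg (sub_nonneg.2 (hq' n)) n) (fun n => ?_)
      (Real.tendsto_exp_neg_atTop_nhds_zero.comp h')
    rw [Function.comp_apply, ← mul_neg, Real.exp_nat_mul]
    exact pow_le_pow_left₀ (sub_nonneg.2 (hq' n)) (Real.one_sub_le_exp_neg _) n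
  · have h' := (ENNReal.tendsto_toReal hr).comp h
    refine (Real.tendsto_one_add_pow_exp_of_tendsto (g := fun n => -(q n).toReal) ?_).congr
      fun n => by rw [sub_eq_add_neg]
    simpa [Function.comp_def] using h'.neg

end void

/-! ### The random cone and the Poisson process as observable random sets -/

section observable

variable {d : ℕ} {Ω : Type*} [MeasurableSpace Ω] {P : Measure Ω}

theorem isObservable_range {n : ℕ} {Y : Fin n → Ω → Euc d} (hY : ∀ i, AEMeasurable (Y i) P) :
    IsObservable (fun ω => Set.range fun i => Y i ω) P := by
  intro A hA
  have hm : Measurable fun y : Fin n → Euc d => ∃ i, y i ∈ A :=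
    Measurable.exists fun i => measurableSet_setOfPred.1 (measurable_pi_apply i hA)
  convert! hm.comp_aemeasurable (aemeasurable_pi_lambda (fun ω i => Y i ω) hY) using 2 with ω
  constructor
  · rintro ⟨_, ⟨i, rfl⟩, hi⟩
    exact ⟨i, hi⟩
  · rintro ⟨i, hi⟩
    exact ⟨_, ⟨i, rfl⟩, hi⟩

/-- The probability that none of `n` independent points with law `ν` lies in a given set. -/
theorem measureReal_range_inter_eq_empty [IsProbabilityMeasure P] {S : Type*} [MeasurableSpace S]
    {ν : Measure S} [IsProbabilityMeasure ν] {n : ℕ} {X : Fin n → Ω → S}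
    (hX : ∀ i, HasLaw (X i) ν P) (hindep : iIndepFun X P) {g : S → Euc d} (hg : Measurable g)
    {A : Set (Euc d)} (hA : MeasurableSet A) :
    P.real {ω | (Set.range fun i => g (X i ω)) ∩ A = ∅} = (1 - (ν (g ⁻¹' A)).toReal) ^ n := by
  have hm : MeasurableSet (g ⁻¹' A)ᶜ := (hg hA).compl
  have h1 : {ω | (Set.range fun i => g (X i ω)) ∩ A = ∅}
      = ⋂ i ∈ Finset.univ, X i ⁻¹' (g ⁻¹' A)ᶜ := by
    ext ω
    simp [Set.eq_empty_iff_forall_notMem]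
  have h2 : ∀ i, P (X i ⁻¹' (g ⁻¹' A)ᶜ) = ν (g ⁻¹' A)ᶜ := by
    intro i
    rw [← (hX i).map_eq, Measure.map_apply_of_aemeasurable (hX i).aemeasurable hm]
  rw [measureReal_def, h1, hindep.measure_inter_preimage_eq_mul _ fun i _ => hm,
    Finset.prod_congr rfl fun i _ => h2 i, Finset.prod_const, Finset.card_univ, Fintype.card_fin,
    ENNReal.toReal_pow, ← measureReal_def, probReal_compl_eq_one_sub (hg hA), measureReal_def]

theorem image_coe_inter_eq_empty_iff {Φ : Set (PuncturedEuc d)} {A : Set (Euc d)} :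
    (fun y : PuncturedEuc d => (y : Euc d)) '' Φ ∩ A = ∅ ↔
      (Φ ∩ (fun y : PuncturedEuc d => (y : Euc d)) ⁻¹' A).encard = 0 := by
  rw [Set.encard_eq_zero, ← Set.image_inter_preimage, Set.image_eq_empty]

variable {Φ : Ω → Set (PuncturedEuc d)} {μ : Measure (PuncturedEuc d)}

theorem IsPoissonProcess.isObservable_image (hΦ : IsPoissonProcess Φ μ P) :
    IsObservable (fun ω => (fun y : PuncturedEuc d => (y : Euc d)) '' Φ ω) P := by
  intro A hA
  refine Measurable.aemeasurable (measurableSet_setOfPred.1 ?_)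
  have := hΦ.measurable_count _ (measurable_subtype_coe hA) (measurableSet_singleton 0).compl
  convert! this using 1
  ext ω
  simp only [Set.mem_ofPred_eq, Set.nonempty_iff_ne_empty, ne_eq, image_coe_inter_eq_empty_iff]
  rfl

theorem IsPoissonProcess.measureReal_inter_eq_empty (hΦ : IsPoissonProcess Φ μ P)
    {A : Set (Euc d)} (hA : MeasurableSet A) :
    P.real {ω | (fun y : PuncturedEuc d => (y : Euc d)) '' Φ ω ∩ A = ∅}
      = (extPoisson (μ ((fun y : PuncturedEuc d => (y : Euc d)) ⁻¹' A))).real {0} := by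
  have hl := hΦ.law_count _ (measurable_subtype_coe hA)
  rw [← hl.map_eq, map_measureReal_apply_of_aemeasurable hl.aemeasurable
    (measurableSet_singleton 0)]
  simp_rw [image_coe_inter_eq_empty_iff]
  rfl

theorem IsPoissonProcess.ae_finite_inter (hΦ : IsPoissonProcess Φ μ P)
    {B : Set (PuncturedEuc d)} (hB : MeasurableSet B) (hμ : μ B < ∞) :
    ∀ᵐ ω ∂P, (Φ ω ∩ B).Finite := by
  have hl := hΦ.law_count B hB
  have h0 : P {ω | (Φ ω ∩ B).encard = ⊤} = 0 := by
    rw [hl.measure_eq (p := fun k => k = ⊤) (measurableSet_singleton _)]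
    exact extPoisson_top hμ.ne
  filter_upwards [measure_eq_zero_iff_ae_notMem.1 h0] with ω hω
  exact Set.encard_ne_top_iff.1 hω

theorem IsPoissonProcess.ae_nonempty_inter [IsProbabilityMeasure P] (hΦ : IsPoissonProcess Φ μ P)
    {A : Set (Euc d)} (hA : MeasurableSet A)
    (hμ : μ ((fun y : PuncturedEuc d => (y : Euc d)) ⁻¹' A) = ∞) :
    ∀ᵐ ω ∂P, ((fun y : PuncturedEuc d => (y : Euc d)) '' Φ ω ∩ A).Nonempty := by
  have h := hΦ.measureReal_inter_eq_empty hA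
  rw [hμ, extPoisson_real_zero, if_pos rfl, measureReal_eq_zero_iff] at h
  filter_upwards [measure_eq_zero_iff_ae_notMem.1 h] with ω hω
  exact Set.nonempty_iff_ne_empty.2 hω

/-- The Poisson process has points in all open orthants and finitely many points away from the
origin. -/
theorem IsPoissonProcess.ae_isCompactConvex [IsProbabilityMeasure P] (hd : 1 ≤ d)
    (hΦ : IsPoissonProcess Φ (poissonIntensity d) P)
    (horth : ∀ σ : Fin d → Bool,
      poissonIntensity d ((fun y : PuncturedEuc d => (y : Euc d)) ⁻¹' orthant σ) = ∞) :
    ∀ᵐ ω ∂P, IsCompactConvex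
      (convexHull ℝ ((fun y : PuncturedEuc d => (y : Euc d)) '' Φ ω)) := by
  have h1 : ∀ᵐ ω ∂P, ∀ σ : Fin d → Bool,
      ((fun y : PuncturedEuc d => (y : Euc d)) '' Φ ω ∩ orthant σ).Nonempty :=
    ae_all_iff.2 fun σ => hΦ.ae_nonempty_inter (isOpen_orthant σ).measurableSet (horth σ)
  have h2 : ∀ᵐ ω ∂P, ∀ k : ℕ, (Φ ω ∩ (fun y : PuncturedEuc d => (y : Euc d)) ⁻¹'
      (Metric.ball 0 (1 / ((k : ℝ) + 1)))ᶜ).Finite :=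
    ae_all_iff.2 fun k => hΦ.ae_finite_inter
      (measurable_subtype_coe Metric.isOpen_ball.measurableSet.compl)
      (poissonIntensity_compl_ball_lt_top hd Nat.one_div_pos_of_nat)
  filter_upwards [h1, h2] with ω hω1 hω2
  refine isCompactConvex_convexHull_of_orthant hω1 fun ρ hρ => ?_
  obtain ⟨k, hk⟩ := exists_nat_one_div_lt hρ
  refine ((hω2 k).image fun y : PuncturedEuc d => (y : Euc d)).subset ?_
  rw [Set.image_inter_preimage]
  exact Set.inter_subset_inter_right _
    (Set.compl_subset_compl.2 (Metric.ball_subset_ball hk.le))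

end observable

/-! ### Convergence of the tangential sections -/

theorem proposition4p1 (d : ℕ) (hd : 1 ≤ d) (e : UnitSphere d)
    (I : Tan e → Euc d) (hI : Isometry I) (hIe : I ⟨e, self_mem_Tan e⟩ = 0)
    {Ω : ℕ → Type*} [∀ n, MeasurableSpace (Ω n)]
    (P : (n : ℕ) → Measure (Ω n)) [∀ n, IsProbabilityMeasure (P n)]
    (X : (n : ℕ) → Fin n → Ω n → UnitSphere d)
    (hX : ∀ n i, HasLaw (X n i) (halfSphereUniform e) (P n))
    (hindep : ∀ n, iIndepFun (X n) (P n))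
    {Ω' : Type*} [MeasurableSpace Ω'] (P' : Measure Ω') [IsProbabilityMeasure P']
    (Φ : Ω' → Set (PuncturedEuc d)) (hΦ : IsPoissonProcess Φ (poissonIntensity d) P') :
    (∀ n : ℕ, 1 ≤ n → ∀ᵐ ω ∂(P n),
      IsCompactConvex ((n : ℝ)⁻¹ • profile e I (posHull fun i => X n i ω))) ∧
    (∀ᵐ ω ∂P', IsCompactConvex (convexHull ℝ ((fun y : PuncturedEuc d => (y : Euc d)) '' Φ ω))) ∧
    TendstoInDistribution
      (fun (n : ℕ) ω => toConvexBody ((n : ℝ)⁻¹ • profile e I (posHull fun i => X n i ω))) atTop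
      (fun ω => toConvexBody (convexHull ℝ ((fun y : PuncturedEuc d => (y : Euc d)) '' Φ ω)))
      P P' := by
  obtain ⟨T, hT1, hT2⟩ := exists_coordinates e I hI hIe
  have := isProbabilityMeasure_halfSphereUniform hT1
  have hg : ∀ n : ℕ, Measurable fun x : UnitSphere d => (n : ℝ)⁻¹ • gnomonic T x := fun n =>
    ((measurable_gnomonic T).comp measurable_subtype_coe).const_smul ((n : ℝ)⁻¹)
  set Ψ : (n : ℕ) → Ω n → Set (Euc d) :=
    fun n ω => Set.range fun i => (n : ℝ)⁻¹ • gnomonic T (X n i ω) with hΨdef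
  -- For `n = 0` both sides are empty, so the identity needs no lower bound on `n`.
  have heq : ∀ n : ℕ, ∀ᵐ ω ∂(P n), (n : ℝ)⁻¹ • profile e I (posHull fun i => X n i ω)
      = convexHull ℝ (Ψ n ω) := by
    intro n
    have hpos : ∀ᵐ ω ∂(P n), ∀ i, 0 < (T (X n i ω)).fst := by
      refine ae_all_iff.2 fun i => ?_
      have h := ae_fst_pos hT1
      rw [← (hX n i).map_eq] at h
      exact ae_of_ae_map (hX n i).aemeasurable h
    filter_upwards [hpos] with ω hω
    rw [profile_posHull hT1 hT2 hω, ← convexHull_smul, ← Set.range_smul]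
  have hΨc : ∀ n, 1 ≤ n → ∀ ω, IsCompactConvex (convexHull ℝ (Ψ n ω)) := fun n hn ω =>
    isCompactConvex_convexHull_of_finite (Set.finite_range _) ⟨_, ⟨⟨0, hn⟩, rfl⟩⟩
  have hΨo : ∀ n, IsObservable (Ψ n) (P n) := fun n =>
    isObservable_range fun i => (hg n).comp_aemeasurable (hX n i).aemeasurable
  have hΦo := hΦ.isObservable_image
  have hΦc := hΦ.ae_isCompactConvex hd (poissonIntensity_orthant hd hT1)
  have hvoid : ∀ A, MeasurableSet A → Tendsto (fun n => (P n).real {ω | Ψ n ω ∩ A = ∅}) atTop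
      (𝓝 (P'.real {ω | (fun y : PuncturedEuc d => (y : Euc d)) '' Φ ω ∩ A = ∅})) := by
    intro A hA
    rw [hΦ.measureReal_inter_eq_empty hA]
    simp_rw [hΨdef, fun n => measureReal_range_inter_eq_empty (hX n) (hindep n) (hg n) hA]
    exact tendsto_one_sub_pow (fun n => prob_le_one) (tendsto_mul_halfSphereUniform hd hT1 hA)
  have haem : ∀ n, AEMeasurable (fun ω => toConvexBody (convexHull ℝ (Ψ n ω))) (P n) := by
    intro n
    rcases Nat.eq_zero_or_pos n with rfl | hn
    · have : ∀ ω, Ψ 0 ω = ∅ := fun ω => Set.range_eq_empty _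
      simp_rw [this]
      exact aemeasurable_const
    · exact (hΨo n).aemeasurable_toConvexBody (.of_forall (hΨc n hn))
  refine ⟨fun n hn => ?_, hΦc, ?_⟩
  · filter_upwards [heq n] with ω hω
    exact hω ▸ hΨc n hn ω
  · have hZ := hΦo.aemeasurable_toConvexBody hΦc
    refine TendstoInDistribution.congr (X := fun n ω => toConvexBody (convexHull ℝ (Ψ n ω)))
      (fun n => ?_) EventuallyEq.rfl ⟨haem, hZ, ?_⟩
    · filter_upwards [heq n] with ω hω
      rw [hω]
    · refine tendsto_iff_forall_lipschitz_integral_tendsto.2 ?_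
      rintro f ⟨C, hC⟩ ⟨L, hL⟩
      have h1 := tendsto_integral_toConvexBody hΨo hΦo
        ((eventually_ge_atTop 1).mono fun n hn => .of_forall (hΨc n hn)) hΦc hvoid hC hL
      rw [← integral_map hZ hL.continuous.measurable.aestronglyMeasurable] at h1
      exact h1.congr fun n =>
        (integral_map (haem n) hL.continuous.measurable.aestronglyMeasurable).symm
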